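/- Let $\Bbbk$ be a field of characteristic $p\ge 3$. A Poisson algebra is a unital commutative $\Bbbk$-algebra $A$ with a $\Bbbk$-bilinear Lie bracket $\{-,-\}$ such that $\{xy,z\}=x\{y,z\}+y\{x,z\}$; write $\mathrm{ad}_x(y)=\{x,y\}$. Put $\Lambda_p(x,y)=\sum_{i=1}^{p-1}\frac{s_i(x,y)}{i}$, where $s_i(x,y)$ is the coefficient of $t^{i-1}$ in $\mathrm{ad}_{tx+y}^{p-1}(x)$, and $$\Phi_p(x,y)=(x^p+y^p)\Lambda_p(x,y)-\tfrac12\bigl(\Lambda_p(x^2,y^2)+\Lambda_p(x^2+y^2,2xy)\bigr).$$ A map $x\mapsto x^{\{p\}}$ on $A$ is called a restricted Lie structure if $\mathrm{ad}_x^p=\mathrm{ad}_{x^{\{p\}}}$, $(\lambda x)^{\{p\}}=\lambda^p x^{\{p\}}$ and $(x+y)^{\{p\}}=x^{\{p\}}+y^{\{p\}}+\Lambda_p(x,y)$ for all $x,y\in A$, $\lambda\in\Bbbk$. Let $T$ be the free associative algebra on $x,y$, let $L\subset T$ be the free Lie algebra (the Lie subalgebra generated by $x,y$), let $F_n=(\Bbbk+L)^n=\Bbbk+L+L^2+\dots+L^n$,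 and let $Q=\bigoplus_n F_nh^n\subset T[h]$ be the Rees algebra, with $x,y\in F_1h$ in degree one and $h=1\cdot h\in F_1h$, and with the bracket determined by $h\{u,v\}=uv-vu$. For every Poisson algebra $A$ and $a,b\in A$ there is a unique $\Bbbk$-algebra homomorphism $Q\to A$ that preserves brackets and sends $h\mapsto 0$, $x\mapsto a$, $y\mapsto b$; the image of $f\in Q$ is denoted $f(a,b)$. Then there is a unique $P\in Q$ with $$h^{p-1}P=(xy)^p-x^py^p,$$ and for every Poisson algebra $A$ over $\Bbbk$ the following hold. 1. $P(a,b)=\Phi_p(a,b)$ for all $a,b\in A$. 2. For every map $x\mapsto x^{\{p\}}$ from $A$ to $A$ the following are equivalent: (a) it is a restricted Lie structure and $(a^2)^{\{p\}}=2a^pa^{\{p\}}$ for all $a\in A$; (b) it is a restricted Lie structure and $(ab)^{\{p\}}=a^pb^{\{p\}}+b^pa^{\{p\}}+P(a,b)$ for all $a,b\in A$ (the definition of a restricted Poisson algebra by Bezrukavnikov and Kaledin). -/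

import Mathlib

namespace RestrictedPoisson

/-! ### Poisson algebras and restricted structures -/

section Basic

/-- A Poisson bracket on a commutative `k`-algebra: a bilinear Lie bracket satisfying the
Leibniz rule. -/
structure PoissonBracket (k A : Type*) [Field k] [CommRing A] [Algebra k A] where
  bracket : A →ₗ[k] A →ₗ[k] A
  self : ∀ x, bracket x x = 0
  jacobi : ∀ x y z,
    bracket x (bracket y z) + bracket y (bracket z x) + bracket z (bracket x y) = 0
  leibniz : ∀ x y z, bracket (x * y) z = x * bracket y z + y * bracket x z

section Lie

variable {k : Type*} [Field k] {A : Type*} [AddCommGroup A] [Module k A]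

/-- `s_i(x, y)`: the coefficient of `t ^ (i - 1)` in `ad_{t x + y} ^ (p - 1) (x)`, computed with
polynomials in a central variable `t` over the algebra of endomorphisms. -/
noncomputable def lieS (br : A →ₗ[k] A →ₗ[k] A) (p i : ℕ) (x y : A) : A :=
  ((Polynomial.X * Polynomial.C (br x : Module.End k A)
    + Polynomial.C (br y : Module.End k A)) ^ (p - 1)).coeff (i - 1) x

/-- `Λ_p(x, y) = ∑_{i = 1}^{p - 1} s_i(x, y) / i`. -/
noncomputable def lieLambda (br : A →ₗ[k] A →ₗ[k] A) (p : ℕ) (x y : A) : A :=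
  ∑ i ∈ Finset.Icc 1 (p - 1), ((i : k)⁻¹) • lieS br p i x y

/-- `pm` is a `p`-map making `(A, br)` a restricted Lie algebra. -/
structure IsRestrictedLie (br : A →ₗ[k] A →ₗ[k] A) (p : ℕ) (pm : A → A) : Prop where
  ad_pow : ∀ x, (br x : Module.End k A) ^ p = br (pm x)
  smul : ∀ (c : k) (x : A), pm (c • x) = c ^ p • pm x
  add : ∀ x y, pm (x + y) = pm x + pm y + lieLambda br p x y

end Lie

variable {k : Type*} [Field k] {A : Type*} [CommRing A] [Algebra k A]

/-- `Φ_p(x, y) = (x^p + y^p) Λ_p(x, y) - (Λ_p(x², y²) + Λ_p(x² + y², 2xy)) / 2`. -/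
noncomputable def poissonPhi (B : PoissonBracket k A) (p : ℕ) (x y : A) : A :=
  (x ^ p + y ^ p) * lieLambda B.bracket p x y
    - (2 : k)⁻¹ • (lieLambda B.bracket p (x ^ 2) (y ^ 2)
        + lieLambda B.bracket p (x ^ 2 + y ^ 2) (2 * (x * y)))

/-- `pm` is a restricted Poisson structure, with the compatibility `(x²)^{p} = 2 x^p x^{p}`. -/
structure IsRestrictedPoisson (B : PoissonBracket k A) (p : ℕ) (pm : A → A) : Prop where
  restrictedLie : IsRestrictedLie B.bracket p pm
  sq : ∀ x, pm (x ^ 2) = 2 * x ^ p * pm x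

end Basic

/-! ### The free quantized algebra on two generators -/

section Quantized

attribute [local instance] LieRing.ofAssociativeRing

variable (k : Type*) [Field k]

/-- The free Lie algebra on `x = ι 0` and `y = ι 1`, as the Lie subalgebra that they generate in
the free (tensor) algebra. -/
def freeLie : LieSubalgebra k (FreeAlgebra k (Fin 2)) :=
  LieSubalgebra.lieSpan k _ (Set.range (FreeAlgebra.ι k))

/-- The Poincaré-Birkhoff-Witt filtration `F_n = k + L + L² + ... + L^n` of the tensor algebra,
where `L` is the free Lie algebra. -/
def pbwFiltration (n : ℕ) : Submodule k (FreeAlgebra k (Fin 2)) :=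
  (1 ⊔ (freeLie k).toSubmodule) ^ n

theorem pbwFiltration_mul_mem {m n : ℕ} {u v : FreeAlgebra k (Fin 2)}
    (hu : u ∈ pbwFiltration k m) (hv : v ∈ pbwFiltration k n) :
    u * v ∈ pbwFiltration k (m + n) := by
  rw [pbwFiltration, pow_add]
  exact Submodule.mul_mem_mul hu hv

/-- The Rees algebra `⊕ F_n h^n` of the Poincaré-Birkhoff-Witt filtration, inside the polynomials
in a central variable `h` over the tensor algebra. -/
noncomputable def reesAlgebra : Subalgebra k (Polynomial (FreeAlgebra k (Fin 2))) where
  carrier := {f | ∀ n, f.coeff n ∈ pbwFiltration k n}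
  mul_mem' := by
    intro f g hf hg n
    rw [Polynomial.coeff_mul]
    refine Submodule.sum_mem _ fun ij hij => ?_
    rw [← Finset.HasAntidiagonal.mem_antidiagonal.1 hij]
    exact pbwFiltration_mul_mem k (hf _) (hg _)
  add_mem' := by
    intro f g hf hg n
    rw [Polynomial.coeff_add]
    exact add_mem (hf n) (hg n)
  algebraMap_mem' := by
    intro r n
    rw [Polynomial.algebraMap_apply, Polynomial.coeff_C]
    split_ifs with h
    · subst h
      rw [pbwFiltration, pow_zero]
      exact Submodule.mem_one.2 ⟨r, rfl⟩
    · exact zero_mem _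

/-- The free quantized algebra on two generators. -/
def FreeQuantized : Type _ := reesAlgebra k

noncomputable instance : Ring (FreeQuantized k) := inferInstanceAs (Ring (reesAlgebra k))

noncomputable instance : Algebra k (FreeQuantized k) :=
  inferInstanceAs (Algebra k (reesAlgebra k))

/-- The inclusion of the free quantized algebra in the polynomials over the tensor algebra. -/
noncomputable def FreeQuantized.val :
    FreeQuantized k →ₐ[k] Polynomial (FreeAlgebra k (Fin 2)) :=
  (reesAlgebra k).val

theorem monomial_mem_reesAlgebra {n : ℕ} {c : FreeAlgebra k (Fin 2)}
    (hc : c ∈ pbwFiltration k n) : Polynomial.monomial n c ∈ reesAlgebra k := by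
  intro m
  rw [Polynomial.coeff_monomial]
  split_ifs with h
  · exact h ▸ hc
  · exact zero_mem _

theorem one_mem_pbwFiltration : (1 : FreeAlgebra k (Fin 2)) ∈ pbwFiltration k 1 := by
  rw [pbwFiltration, pow_one]
  exact Submodule.mem_sup_left (Submodule.one_le.1 le_rfl)

theorem freeLie_mem_pbwFiltration {l : FreeAlgebra k (Fin 2)} (hl : l ∈ freeLie k) :
    l ∈ pbwFiltration k 1 := by
  rw [pbwFiltration, pow_one]
  exact Submodule.mem_sup_right hl

theorem ι_mem_freeLie (i : Fin 2) : FreeAlgebra.ι k i ∈ freeLie k :=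
  LieSubalgebra.subset_lieSpan ⟨i, rfl⟩

/-- The quantization parameter `h`, i.e. `1 ∈ F_1` in degree one. -/
noncomputable def quantH : FreeQuantized k :=
  ⟨Polynomial.monomial 1 1, monomial_mem_reesAlgebra k (one_mem_pbwFiltration k)⟩

/-- A Lie element, in degree one. -/
noncomputable def quantLie (l : freeLie k) : FreeQuantized k :=
  ⟨Polynomial.monomial 1 l.1,
    monomial_mem_reesAlgebra k (freeLie_mem_pbwFiltration k l.2)⟩

/-- The generator `x`. -/
noncomputable def quantX : FreeQuantized k := quantLie k ⟨_, ι_mem_freeLie k 0⟩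

/-- The generator `y`. -/
noncomputable def quantY : FreeQuantized k := quantLie k ⟨_, ι_mem_freeLie k 1⟩

end Quantized

/-! ### Quantized polynomials as operations on Poisson algebras -/

section Evaluation

variable {k : Type*} [Field k] {A : Type*} [CommRing A] [Algebra k A]

/-- `φ` is a morphism of quantized algebras from the free quantized algebra to the Poisson
algebra `A` (on which `h` acts by zero) with `x ↦ a` and `y ↦ b`. The bracket of `u` and `v` in
the free quantized algebra is the element `w` such that `h w = u v - v u`. -/
structure IsEvaluation (B : PoissonBracket k A) (a b : A) (φ : FreeQuantized k →ₐ[k] A) :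
    Prop where
  map_h : φ (quantH k) = 0
  map_x : φ (quantX k) = a
  map_y : φ (quantY k) = b
  map_bracket : ∀ u v w : FreeQuantized k, quantH k * w = u * v - v * u →
    φ w = B.bracket (φ u) (φ v)

end Evaluation

/-! ### The action of a Lie algebra on its symmetric algebra

The Poincaré-Birkhoff-Witt theorem, in the form of an action of a Lie algebra with a basis on the
polynomials in that basis, where a Lie algebra element acts by multiplication up to terms of lower
degree. It is used only for the universal property of the free quantized algebra. -/

section LieAction

open MvPolynomial

variable {k : Type*} [Field k] {A : Type*} [AddCommGroup A] [Module k A]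
  {ι : Type*}

/-- Polynomials all of whose monomials have degree `< d`. -/
noncomputable def degLT (k : Type*) [Field k] (ι : Type*) (d : ℕ) : Submodule k (MvPolynomial ι k) :=
  Submodule.span k {f | ∃ m : ι →₀ ℕ, m.degree < d ∧ f = monomial m 1}

theorem monomial_mem_degLT {m : ι →₀ ℕ} {d : ℕ} (h : m.degree < d) :
    (monomial m 1 : MvPolynomial ι k) ∈ degLT k ι d :=
  Submodule.subset_span ⟨m, h, rfl⟩

theorem degLT_mono {d e : ℕ} (h : d ≤ e) : degLT k ι d ≤ degLT k ι e := by
  apply Submodule.span_mono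
  rintro _ ⟨m, hm, rfl⟩
  exact ⟨m, hm.trans_le h, rfl⟩

theorem degLT_le {d : ℕ} {K : Submodule k (MvPolynomial ι k)}
    (h : ∀ m : ι →₀ ℕ, m.degree < d → monomial m 1 ∈ K) : degLT k ι d ≤ K := by
  apply Submodule.span_le.2
  rintro _ ⟨m, hm, rfl⟩
  exact h m hm

theorem X_mul_monomial' (a : ι) (m : ι →₀ ℕ) :
    (X a * monomial m 1 : MvPolynomial ι k) = monomial (m + Finsupp.single a 1) 1 := by
  rw [X, monomial_mul, one_mul, add_comm]

theorem X_mul_mem {d : ℕ} (a : ι) {f : MvPolynomial ι k} (hf : f ∈ degLT k ι d) :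
    X a * f ∈ degLT k ι (d + 1) := by
  refine (degLT_le (K := (degLT k ι (d + 1)).comap (LinearMap.mulLeft k (X a))) ?_) hf
  intro m hm
  simp only [Submodule.mem_comap, LinearMap.mulLeft_apply, X_mul_monomial']
  apply monomial_mem_degLT
  simpa [Finsupp.degree_single] using hm

theorem degLT_zero : degLT k ι 0 = ⊥ := by
  rw [eq_bot_iff]
  exact degLT_le fun m hm => by simp at hm

theorem constr_apply_mem (b : Module.Basis ι k A) {K : Submodule k (MvPolynomial ι k)}
    (f : ι → (MvPolynomial ι k →ₗ[k] MvPolynomial ι k)) (g : MvPolynomial ι k)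
    (h : ∀ a, f a g ∈ K) (u : A) : b.constr k f u g ∈ K := by
  rw [Module.Basis.constr_apply, Finsupp.sum, LinearMap.sum_apply]
  exact K.sum_mem fun i _ => K.smul_mem _ (h i)

variable [LinearOrder ι]

/-- `a` is at most all indices occurring in `m`. -/
def LowerIdx (a : ι) (m : ι →₀ ℕ) : Prop := ∀ j ∈ m.support, a ≤ j

theorem exists_min {a : ι} {m : ι →₀ ℕ} (h : ¬ LowerIdx a m) :
    ∃ c m', m = m' + Finsupp.single c 1 ∧ c < a ∧ LowerIdx c m' := by
  simp only [LowerIdx, not_forall, not_le] at h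
  obtain ⟨j, hj, hja⟩ := h
  have hne : m.support.Nonempty := ⟨j, hj⟩
  set c := m.support.min' hne with hc
  have hcm : c ∈ m.support := m.support.min'_mem hne
  refine ⟨c, m - Finsupp.single c 1, ?_, (m.support.min'_le j hj).trans_lt hja, ?_⟩
  · rw [tsub_add_cancel_of_le]
    simpa [Finsupp.single_le_iff] using Nat.one_le_iff_ne_zero.2 (Finsupp.mem_support_iff.1 hcm)
  · intro i hi
    apply m.support.min'_le
    exact Finsupp.support_tsub hi

variable (br : A →ₗ[k] A →ₗ[k] A) (b : Module.Basis ι k A)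

open Classical in
/-- Truncated action of the basis vectors of a Lie algebra on the symmetric algebra. -/
noncomputable def actN : ℕ → ι → (MvPolynomial ι k →ₗ[k] MvPolynomial ι k)
  | 0, a => LinearMap.mulLeft k (X a)
  | n + 1, a => (basisMonomials ι k).constr k fun m =>
      if h : LowerIdx a m then X a * monomial m 1
      else X a * monomial m 1
        + actN n (exists_min h).choose
            (actN n a (monomial (exists_min h).choose_spec.choose 1)
              - X a * monomial (exists_min h).choose_spec.choose 1)
        + b.constr k (actN n) (br (b a) (b (exists_min h).choose))
            (monomial (exists_min h).choose_spec.choose 1)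

open Classical in
theorem actN_succ (n : ℕ) (a : ι) (m : ι →₀ ℕ) :
    actN br b (n + 1) a (monomial m 1) =
      if h : LowerIdx a m then X a * monomial m 1
      else X a * monomial m 1
        + actN br b n (exists_min h).choose
            (actN br b n a (monomial (exists_min h).choose_spec.choose 1)
              - X a * monomial (exists_min h).choose_spec.choose 1)
        + b.constr k (actN br b n) (br (b a) (b (exists_min h).choose))
            (monomial (exists_min h).choose_spec.choose 1) := by
  rw [actN]
  have : (monomial m 1 : MvPolynomial ι k) = basisMonomials ι k m := by simp
  rw [this, Module.Basis.constr_basis]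
  simp

theorem min_unique {c c' : ι} {m m' : ι →₀ ℕ} (hc : LowerIdx c m) (hc' : LowerIdx c' m')
    (h : m + Finsupp.single c 1 = m' + Finsupp.single c' 1) : c = c' ∧ m = m' := by
  have key : ∀ {c c' : ι} {m m' : ι →₀ ℕ}, LowerIdx c m →
      m + Finsupp.single c 1 = m' + Finsupp.single c' 1 → c ≤ c' := by
    intro c c' m m' hc h
    by_contra hlt
    have h1 := DFunLike.congr_fun h c'
    have hne : c ≠ c' := fun e => hlt e.le
    simp [hne] at h1
    exact hlt (hc c' (by simp [h1]))
  have e : c = c' := le_antisymm (key hc h) (key hc' h.symm)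
  subst e
  exact ⟨rfl, add_right_cancel h⟩

theorem actN_sub_mem (n : ℕ) : ∀ (a : ι) (m : ι →₀ ℕ), m.degree ≤ n →
    actN br b n a (monomial m 1) - X a * monomial m 1 ∈ degLT k ι (m.degree + 1) := by
  induction n with
  | zero => intro a m _; simp [actN]
  | succ n ih =>
    have ih1 : ∀ a d, d ≤ n → ∀ f ∈ degLT k ι (d + 1),
        actN br b n a f - X a * f ∈ degLT k ι (d + 1) := by
      intro a d hd f hf
      refine (degLT_le (K := (degLT k ι (d + 1)).comap
        (actN br b n a - LinearMap.mulLeft k (X a))) ?_) hf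
      intro m hm
      simp only [Submodule.mem_comap, LinearMap.sub_apply, LinearMap.mulLeft_apply]
      exact degLT_mono (by omega) (ih a m (by omega))
    have ih2 : ∀ a d, d ≤ n → ∀ f ∈ degLT k ι (d + 1),
        actN br b n a f ∈ degLT k ι (d + 2) := by
      intro a d hd f hf
      have := add_mem (degLT_mono (Nat.le_succ _) (ih1 a d hd f hf)) (X_mul_mem a hf)
      simpa using this
    intro a m hm
    rw [actN_succ]
    split_ifs with h
    · simp
    · obtain ⟨hm', -, -⟩ := (exists_min h).choose_spec.choose_spec
      set c := (exists_min h).choose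
      set m' := (exists_min h).choose_spec.choose
      have hdeg : m.degree = m'.degree + 1 := by rw [hm']; simp [Finsupp.degree_single]
      rw [add_assoc, add_sub_cancel_left, hdeg]
      apply add_mem
      · exact ih2 c _ (by omega) _ (ih a m' (by omega))
      · exact constr_apply_mem b _ _
          (fun i => ih2 i _ (by omega) _ (monomial_mem_degLT (Nat.lt_succ_self _))) _

theorem actN_stable (n : ℕ) : ∀ (a : ι) (m : ι →₀ ℕ), m.degree ≤ n →
    actN br b (n + 1) a (monomial m 1) = actN br b n a (monomial m 1) := by
  induction n with
  | zero =>
    intro a m hm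
    have : m = 0 := (Finsupp.degree_eq_zero_iff m).1 (by omega)
    subst this
    rw [actN_succ, dif_pos (by simp [LowerIdx])]
    simp [actN]
  | succ n ih =>
    have ih1 : ∀ a, ∀ f ∈ degLT k ι (n + 1), actN br b (n + 1) a f = actN br b n a f := by
      intro a f hf
      rw [← sub_eq_zero, ← LinearMap.sub_apply, ← LinearMap.mem_ker]
      refine (degLT_le (K := LinearMap.ker (actN br b (n + 1) a - actN br b n a)) ?_) hf
      intro m hm
      rw [LinearMap.mem_ker, LinearMap.sub_apply, ih a m (by omega), sub_self]
    intro a m hm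
    rw [actN_succ, actN_succ br b n]
    split_ifs with h
    · rfl
    · obtain ⟨hm', -, -⟩ := (exists_min h).choose_spec.choose_spec
      set c := (exists_min h).choose
      set m' := (exists_min h).choose_spec.choose
      have hdeg : m.degree = m'.degree + 1 := by rw [hm']; simp [Finsupp.degree_single]
      have h1 : m'.degree < n + 1 := by omega
      rw [ih1 a _ (monomial_mem_degLT h1), ih1 c _ (degLT_mono (by omega)
        (actN_sub_mem br b n a m' (by omega)))]
      congr 1
      rw [Module.Basis.constr_apply, Module.Basis.constr_apply, Finsupp.sum, Finsupp.sum,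
        LinearMap.sum_apply, LinearMap.sum_apply]
      refine Finset.sum_congr rfl fun i _ => ?_
      rw [LinearMap.smul_apply, LinearMap.smul_apply, ih1 i _ (monomial_mem_degLT h1)]

/-- The action of the basis vectors of a Lie algebra on the symmetric algebra. -/
noncomputable def act (a : ι) : MvPolynomial ι k →ₗ[k] MvPolynomial ι k :=
  (basisMonomials ι k).constr k fun m => actN br b m.degree a (monomial m 1)

theorem act_monomial (a : ι) (m : ι →₀ ℕ) :
    act br b a (monomial m 1) = actN br b m.degree a (monomial m 1) := by
  rw [act]
  have : (monomial m 1 : MvPolynomial ι k) = basisMonomials ι k m := by simp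
  conv_lhs => rw [this, Module.Basis.constr_basis]

theorem act_eq_actN {n : ℕ} (a : ι) {f : MvPolynomial ι k} (hf : f ∈ degLT k ι (n + 1)) :
    act br b a f = actN br b n a f := by
  rw [← sub_eq_zero, ← LinearMap.sub_apply, ← LinearMap.mem_ker]
  refine (degLT_le (K := LinearMap.ker (act br b a - actN br b n a)) ?_) hf
  intro m hm
  rw [LinearMap.mem_ker, LinearMap.sub_apply, sub_eq_zero, act_monomial]
  obtain ⟨e, rfl⟩ : ∃ e, n = m.degree + e := ⟨n - m.degree, by omega⟩
  clear hm hf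
  induction e with
  | zero => rfl
  | succ e ih => rw [ih, ← add_assoc, actN_stable br b (m.degree + e) a m (by omega)]

/-- The action of a Lie algebra on the symmetric algebra. -/
noncomputable def lieAct : A →ₗ[k] (MvPolynomial ι k →ₗ[k] MvPolynomial ι k) :=
  b.constr k (act br b)

theorem lieAct_basis (a : ι) : lieAct br b (b a) = act br b a := by
  rw [lieAct, Module.Basis.constr_basis]

theorem act_sub_mem (a : ι) {d : ℕ} {f : MvPolynomial ι k} (hf : f ∈ degLT k ι (d + 1)) :
    act br b a f - X a * f ∈ degLT k ι (d + 1) := by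
  refine (degLT_le (K := (degLT k ι (d + 1)).comap
    (act br b a - LinearMap.mulLeft k (X a))) ?_) hf
  intro m hm
  simp only [Submodule.mem_comap, LinearMap.sub_apply, LinearMap.mulLeft_apply, act_monomial]
  exact degLT_mono (by omega) (actN_sub_mem br b _ a m le_rfl)

theorem act_of_lower {a : ι} {m : ι →₀ ℕ} (h : LowerIdx a m) :
    act br b a (monomial m 1) = X a * monomial m 1 := by
  rw [act_eq_actN br b a (monomial_mem_degLT (d := m.degree + 2) (by omega)), actN_succ,
    dif_pos h]

theorem act_act_of_lower {a c : ι} {m : ι →₀ ℕ} (hca : c < a) (h : LowerIdx c m) :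
    act br b a (act br b c (monomial m 1)) =
      act br b c (act br b a (monomial m 1)) + lieAct br b (br (b a) (b c)) (monomial m 1) := by
  have hX : LowerIdx c (m + Finsupp.single a 1) := by
    intro j hj
    rcases Finset.mem_union.1 (Finsupp.support_add hj) with hj | hj
    · exact h j hj
    · have := Finsupp.support_single_subset hj
      rw [Finset.mem_singleton.1 this]
      exact hca.le
  have h1 : ¬ LowerIdx a (m + Finsupp.single c 1) := by
    intro h2
    exact absurd (h2 c (by simp)) (not_le.2 hca)
  have hdeg : (m + Finsupp.single c 1).degree = m.degree + 1 := by
    simp [Finsupp.degree_single]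
  rw [act_of_lower br b h, X_mul_monomial', act_monomial, hdeg, actN_succ, dif_neg h1]
  obtain ⟨hm', -, hl⟩ := (exists_min h1).choose_spec.choose_spec
  obtain ⟨hc, hm⟩ := min_unique h hl hm'
  rw [← hm, ← hc]
  have hmem : (monomial m 1 : MvPolynomial ι k) ∈ degLT k ι (m.degree + 1) :=
    monomial_mem_degLT (Nat.lt_succ_self _)
  rw [← act_eq_actN br b a hmem, ← act_eq_actN br b c (act_sub_mem br b a hmem), map_sub,
    X_mul_monomial' a m, act_of_lower br b hX, ← X_mul_monomial', ← X_mul_monomial']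
  have : b.constr k (actN br b m.degree) (br (b a) (b c)) (monomial m 1)
      = lieAct br b (br (b a) (b c)) (monomial m 1) := by
    rw [lieAct, Module.Basis.constr_apply, Module.Basis.constr_apply, Finsupp.sum, Finsupp.sum,
      LinearMap.sum_apply, LinearMap.sum_apply]
    refine Finset.sum_congr rfl fun i _ => ?_
    rw [LinearMap.smul_apply, LinearMap.smul_apply, act_eq_actN br b i hmem]
  rw [this]
  ring

theorem lieAct_lie (hself : ∀ u, br u u = 0)
    (hjac : ∀ u v w, br u (br v w) + br v (br w u) + br w (br u v) = 0) (u v : A)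
    (f : MvPolynomial ι k) :
    lieAct br b u (lieAct br b v f) - lieAct br b v (lieAct br b u f)
      = lieAct br b (br u v) f := by
  have hskew : ∀ u v, br v u = - br u v := by
    intro u v
    have := hself (u + v)
    simp only [map_add, LinearMap.add_apply, hself, zero_add, add_zero] at this
    exact eq_neg_of_add_eq_zero_left this
  let K : Submodule k (MvPolynomial ι k) :=
    ⨅ u : A, ⨅ v : A, LinearMap.ker (lieAct br b u ∘ₗ lieAct br b v - lieAct br b v ∘ₗ lieAct br b u
      - lieAct br b (br u v))
  have hK : ∀ f, f ∈ K ↔ ∀ u v, lieAct br b u (lieAct br b v f)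
      = lieAct br b v (lieAct br b u f) + lieAct br b (br u v) f := by
    intro f
    simp only [K, Submodule.mem_iInf, LinearMap.mem_ker, LinearMap.sub_apply,
      LinearMap.comp_apply, sub_sub, sub_eq_zero]
    simp only [LinearMap.add_apply, LinearMap.comp_apply]
  have hKb : ∀ f, (∀ a c, act br b a (act br b c f)
      = act br b c (act br b a f) + lieAct br b (br (b a) (b c)) f) → f ∈ K := by
    intro f h
    rw [hK]
    let P : A →ₗ[k] A →ₗ[k] MvPolynomial ι k :=
      LinearMap.mk₂ k (fun u v => lieAct br b u (lieAct br b v f)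
        - (lieAct br b v (lieAct br b u f) + lieAct br b (br u v) f))
        (by intros; simp; ring) (by intros; simp [smul_sub])
        (by intros; simp; ring) (by intros; simp [smul_sub])
    have hP : P = 0 := b.ext fun a => b.ext fun c => by
      simp [P, lieAct_basis, h a c]
    intro u v
    have := congrArg (fun Q => Q u v) hP
    simpa [P, sub_eq_zero] using this
  have main : ∀ n, ∀ m : ι →₀ ℕ, m.degree = n → monomial m 1 ∈ K := by
    intro n
    induction n using Nat.strong_induction_on with
    | _ n ih =>
    intro m hm
    have hlt : ∀ d, d ≤ n → degLT k ι d ≤ K := fun d hd =>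
      degLT_le fun m' hm' => ih _ (by omega) m' rfl
    have low : ∀ {a c : ι}, c ≤ a → LowerIdx c m → 
        act br b a (act br b c (monomial m 1))
      = act br b c (act br b a (monomial m 1)) + lieAct br b (br (b a) (b c)) (monomial m 1) := by
      intro a c hca hc
      rcases hca.eq_or_lt with rfl | hca
      · simp [hself]
      · exact act_act_of_lower br b hca hc
    have flip : ∀ {a c : ι}, act br b a (act br b c (monomial m 1))
      = act br b c (act br b a (monomial m 1)) + lieAct br b (br (b a) (b c)) (monomial m 1) →
       act br b c (act br b a (monomial m 1))
      = act br b a (act br b c (monomial m 1)) + lieAct br b (br (b c) (b a)) (monomial m 1) := by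
      intro a c h
      rw [h, hskew (b a) (b c)]
      simp
    apply hKb
    intro a c
    wlog hca : c ≤ a generalizing a c
    · exact flip (this c a (le_of_not_ge hca))
    by_cases hc : LowerIdx c m
    · exact low hca hc
    obtain ⟨e, m', rfl, hec, hem⟩ := exists_min hc
    have hea : e < a := hec.trans_le hca
    have hdeg : m'.degree + 1 = n := by rw [← hm]; simp [Finsupp.degree_single]
    set P : MvPolynomial ι k := monomial m' 1 with hPdef
    have hPm : P ∈ degLT k ι (m'.degree + 1) := monomial_mem_degLT (Nat.lt_succ_self _)
    have hPK := (hK P).1 (hlt _ (by omega) hPm)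
    have key : ∀ {x y : ι}, e < x → e < y → act br b x (act br b e (act br b y P))
        = act br b e (act br b x (act br b y P))
          + lieAct br b (br (b x) (b e)) (act br b y P) := by
      intro x y hx hy
      have h1 : act br b y P = monomial (m' + Finsupp.single y 1) 1
          + (act br b y P - X y * P) := by rw [← X_mul_monomial']; ring
      have h2 : act br b y P - X y * P ∈ K := hlt _ (by omega) (act_sub_mem br b y hPm)
      have h3 := (hK _).1 h2 (b x) (b e)
      simp only [lieAct_basis] at h3
      have hX : LowerIdx e (m' + Finsupp.single y 1) := by
        intro j hj
        rcases Finset.mem_union.1 (Finsupp.support_add hj) with hj | hj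
        · exact hem j hj
        · have := Finsupp.support_single_subset hj
          rw [Finset.mem_singleton.1 this]
          exact hy.le
      have h4 := act_act_of_lower br b hx hX
      rw [h1]
      simp only [map_add (act br b e), map_add (act br b x), map_add (lieAct br b _), h3, h4]
      ring
    have hm1 : (monomial (m' + Finsupp.single e 1) 1 : MvPolynomial ι k) = act br b e P := by
      rw [act_of_lower br b hem, X_mul_monomial']
    rw [hm1]
    have e1 : ∀ x y, act br b x (act br b y P)
        = act br b y (act br b x P) + lieAct br b (br (b x) (b y)) P := by
      intro x y
      simpa only [lieAct_basis] using hPK (b x) (b y)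
    have e2 : ∀ u y, lieAct br b u (act br b y P)
        = act br b y (lieAct br b u P) + lieAct br b (br u (b y)) P := by
      intro u y
      simpa only [lieAct_basis] using hPK u (b y)
    have J : br (br (b a) (b e)) (b c) + br (b a) (br (b c) (b e))
        = br (br (b a) (b c)) (b e) := by
      have := hjac (b a) (b c) (b e)
      rw [hskew (b c) (br (b a) (b e)), hskew (b e) (br (b a) (b c)), hskew (b e) (b a), map_neg,
        neg_neg, add_comm, eq_neg_iff_add_eq_zero]
      exact this
    rw [e1 c e, e1 a e, map_add, map_add, key hea hec, key hec hea, e2 _ e, ← J, map_add,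
      e2 (br (b a) (b e)) c, e1 a c, map_add (act br b e)]
    have e3 : act br b a (lieAct br b (br (b c) (b e)) P)
        = lieAct br b (br (b c) (b e)) (act br b a P)
          + lieAct br b (br (b a) (br (b c) (b e))) P := by
      simpa only [lieAct_basis] using hPK (b a) (br (b c) (b e))
    rw [e3]
    simp only [LinearMap.add_apply]
    ring
  have : f ∈ K := by
    have h1 : f ∈ Submodule.span k (Set.range (basisMonomials ι k)) := by
      rw [(basisMonomials ι k).span_eq]
      trivial
    refine Submodule.span_le.2 ?_ h1
    rintro _ ⟨m, rfl⟩
    simpa using main _ m rfl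
  rw [(hK f).1 this u v]
  ring

end LieAction

section Existence

attribute [local instance] LieRing.ofAssociativeRing

variable {k : Type*} [Field k]

theorem quantH_mul_coeff (w : FreeQuantized k) (n : ℕ) :
    (quantH k * w).1.coeff (n + 1) = w.1.coeff n := by
  change (Polynomial.monomial 1 1 * w.1).coeff (n + 1) = _
  rw [Polynomial.coeff_monomial_mul, one_mul]

theorem quantH_mul_cancel {w w' : FreeQuantized k} (h : quantH k * w = quantH k * w') :
    w = w' := by
  apply Subtype.ext
  ext1 n
  rw [← quantH_mul_coeff, h, quantH_mul_coeff]

theorem quantH_comm (w : FreeQuantized k) : quantH k * w = w * quantH k := by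
  apply Subtype.ext
  change Polynomial.monomial 1 1 * w.1 = w.1 * Polynomial.monomial 1 1
  rw [Polynomial.monomial_one_one_eq_X, Polynomial.X_mul]

theorem quantH_mul_lie (l l' : freeLie k) :
    quantH k * quantLie k ⟨⁅l.1, l'.1⁆, (freeLie k).lie_mem l.2 l'.2⟩
      = quantLie k l * quantLie k l' - quantLie k l' * quantLie k l := by
  apply Subtype.ext
  change Polynomial.monomial 1 1 * Polynomial.monomial 1 ⁅l.1, l'.1⁆
    = Polynomial.monomial 1 l.1 * Polynomial.monomial 1 l'.1
      - Polynomial.monomial 1 l'.1 * Polynomial.monomial 1 l.1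
  simp only [Polynomial.monomial_mul_monomial, one_mul, ← map_sub]
  rfl

theorem freeQuantized_generated {C : Subalgebra k (FreeQuantized k)} (hh : quantH k ∈ C)
    (hl : ∀ l, quantLie k l ∈ C) : C = ⊤ := by
  have mono : ∀ n, ∀ c ∈ pbwFiltration k n,
      Polynomial.monomial n c ∈ C.map (FreeQuantized.val k) := by
    intro n
    induction n with
    | zero =>
      intro c hc
      rw [pbwFiltration, pow_zero] at hc
      obtain ⟨r, rfl⟩ := Submodule.mem_one.1 hc
      exact (C.map (FreeQuantized.val k)).algebraMap_mem r
    | succ n ih =>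
      intro c hc
      rw [pbwFiltration, pow_succ'] at hc
      refine Submodule.mul_induction_on hc ?_ ?_
      · intro u hu v hv
        have : Polynomial.monomial (n + 1) (u * v)
            = Polynomial.monomial 1 u * Polynomial.monomial n v := by
          rw [Polynomial.monomial_mul_monomial, add_comm]
        rw [this]
        refine mul_mem ?_ (ih v hv)
        obtain ⟨r, hr, l, hl', rfl⟩ := Submodule.mem_sup.1 hu
        obtain ⟨r, rfl⟩ := Submodule.mem_one.1 hr
        rw [map_add]
        refine add_mem ?_ ⟨_, hl ⟨l, hl'⟩, rfl⟩
        have : Polynomial.monomial 1 (algebraMap k (FreeAlgebra k (Fin 2)) r)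
            = r • (Polynomial.monomial 1 1) := by
          rw [Polynomial.smul_monomial, Algebra.algebraMap_eq_smul_one]
        rw [this]
        exact Subalgebra.smul_mem _ (show _ ∈ C.map (FreeQuantized.val k) from ⟨_, hh, rfl⟩) r
      · intro u v hu hv
        rw [map_add]
        exact add_mem hu hv
  rw [eq_top_iff]
  rintro f -
  have hf : f.1 ∈ C.map (FreeQuantized.val k) := by
    rw [f.1.as_sum_support]
    exact sum_mem fun n _ => mono n _ (f.2 n)
  obtain ⟨g, hg, hgf⟩ := hf
  have : g = f := Subtype.ext hgf
  exact this ▸ hg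

variable {A : Type*} [CommRing A] [Algebra k A]

theorem PoissonBracket.skew (B : PoissonBracket k A) (u v : A) :
    B.bracket v u = - B.bracket u v := by
  have := B.self (u + v)
  simp only [map_add, LinearMap.add_apply, B.self, zero_add, add_zero] at this
  exact eq_neg_of_add_eq_zero_left this

theorem PoissonBracket.bracket_algebraMap (B : PoissonBracket k A) (r : k) (v : A) :
    B.bracket (algebraMap k A r) v = 0 := by
  have h := B.leibniz 1 1 v
  simp only [mul_one, one_mul, left_eq_add] at h
  rw [Algebra.algebraMap_eq_smul_one, map_smul, LinearMap.smul_apply, h, smul_zero]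

theorem evaluation_unique (B : PoissonBracket k A) {a b : A} {φ ψ : FreeQuantized k →ₐ[k] A}
    (hφ : IsEvaluation B a b φ) (hψ : IsEvaluation B a b ψ) : φ = ψ := by
  have : AlgHom.equalizer φ ψ = ⊤ := by
    apply freeQuantized_generated
    · change φ _ = ψ _
      rw [hφ.map_h, hψ.map_h]
    · rintro ⟨l, hl⟩
      change φ _ = ψ _
      refine LieSubalgebra.lieSpan_induction
        (p := fun l hl => φ (quantLie k ⟨l, hl⟩) = ψ (quantLie k ⟨l, hl⟩)) k ?_ ?_ ?_ ?_ ?_ hl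
      · rintro _ ⟨i, rfl⟩
        fin_cases i
        · exact hφ.map_x.trans hψ.map_x.symm
        · exact hφ.map_y.trans hψ.map_y.symm
      · have : quantLie k ⟨0, zero_mem _⟩ = 0 := Subtype.ext (map_zero _)
        exact (congrArg φ this).trans (by rw [map_zero, ← map_zero ψ, ← this])
      · intro x y hx hy h1 h2
        have : quantLie k ⟨x + y, add_mem hx hy⟩ = quantLie k ⟨x, hx⟩ + quantLie k ⟨y, hy⟩ :=
          Subtype.ext (map_add _ _ _)
        exact (congrArg φ this).trans (by rw [map_add, h1, h2, ← map_add ψ, ← this])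
      · intro r x hx h1
        have : quantLie k ⟨r • x, (freeLie k).smul_mem r hx⟩ = r • quantLie k ⟨x, hx⟩ :=
          Subtype.ext (Polynomial.smul_monomial _ _ _).symm
        exact (congrArg φ this).trans (by rw [map_smul, h1, ← map_smul ψ, ← this])
      · intro x y hx hy h1 h2
        have := quantH_mul_lie ⟨x, hx⟩ ⟨y, hy⟩
        exact (hφ.map_bracket _ _ _ this).trans
          (by rw [h1, h2]; exact (hψ.map_bracket _ _ _ this).symm)
  exact AlgHom.ext fun u => (this.symm ▸ Algebra.mem_top : u ∈ AlgHom.equalizer φ ψ)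

/-- Compatibility with the brackets only has to be checked on Lie elements. -/
theorem map_bracket_of_lie (B : PoissonBracket k A) (φ : FreeQuantized k →ₐ[k] A)
    (h0 : φ (quantH k) = 0)
    (hl : ∀ l l' : freeLie k,
      φ (quantLie k ⟨⁅l.1, l'.1⁆, (freeLie k).lie_mem l.2 l'.2⟩)
        = B.bracket (φ (quantLie k l)) (φ (quantLie k l')))
    (u v w : FreeQuantized k) (hw : quantH k * w = u * v - v * u) :
    φ w = B.bracket (φ u) (φ v) := by
  let D : FreeQuantized k → FreeQuantized k → Prop := fun u v =>
    ∃ w, quantH k * w = u * v - v * u ∧ φ w = B.bracket (φ u) (φ v)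
  have hskew : ∀ {u v}, D u v → D v u := by
    rintro u v ⟨w, hw, hφ⟩
    exact ⟨-w, by rw [mul_neg, hw, neg_sub], by rw [map_neg, hφ, ← B.skew]⟩
  let C : FreeQuantized k → Subalgebra k (FreeQuantized k) := fun v =>
    { carrier := {u | D u v}
      mul_mem' := by
        rintro u u' ⟨w, hw, hφ⟩ ⟨w', hw', hφ'⟩
        refine ⟨u * w' + w * u', ?_, ?_⟩
        · rw [mul_add, ← mul_assoc, quantH_comm u, mul_assoc, hw', ← mul_assoc, hw]
          noncomm_ring
        · rw [map_add, map_mul, map_mul, map_mul, hφ, hφ', B.leibniz]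
          ring
      add_mem' := by
        rintro u u' ⟨w, hw, hφ⟩ ⟨w', hw', hφ'⟩
        refine ⟨w + w', ?_, ?_⟩
        · rw [mul_add, hw, hw']
          noncomm_ring
        · simp only [map_add, hφ, hφ', LinearMap.add_apply]
      algebraMap_mem' := by
        intro r
        refine ⟨0, ?_, ?_⟩
        · rw [mul_zero, Algebra.commutes, sub_self]
        · rw [map_zero, AlgHom.commutes, B.bracket_algebraMap] }
  have hh : ∀ v, D (quantH k) v := fun v =>
    ⟨0, by rw [mul_zero, quantH_comm, sub_self], by rw [map_zero, h0, map_zero]; rfl⟩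
  have step1 : ∀ l v, D v (quantLie k l) := by
    intro l v
    have : C (quantLie k l) = ⊤ :=
      freeQuantized_generated (hh _) fun l' => ⟨_, quantH_mul_lie l' l, hl l' l⟩
    exact (this.symm ▸ Algebra.mem_top : v ∈ C (quantLie k l))
  have step2 : ∀ u v, D u v := by
    intro u v
    have : C v = ⊤ := freeQuantized_generated (hh _) fun l => hskew (step1 l v)
    exact (this.symm ▸ Algebra.mem_top : u ∈ C v)
  obtain ⟨w', hw', hφ⟩ := step2 u v
  rw [← hφ, quantH_mul_cancel (hw.trans hw'.symm)]

section Symbol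

open MvPolynomial

variable {ι : Type*}

/-- `s` is the leading term, of order `n`, of the operator `D`. -/
def HasSymbol (n : ℕ) (D : MvPolynomial ι k →ₗ[k] MvPolynomial ι k) (s : MvPolynomial ι k) :
    Prop :=
  s.IsHomogeneous n ∧ ∀ d, ∀ f ∈ degLT k ι (d + 1), D f - s * f ∈ degLT k ι (n + d)

theorem homogeneousComponent_degLT {n : ℕ} {f : MvPolynomial ι k} (hf : f ∈ degLT k ι n) :
    homogeneousComponent n f = 0 := by
  classical
  refine (degLT_le (K := LinearMap.ker (homogeneousComponent n)) ?_) hf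
  intro m hm
  rw [LinearMap.mem_ker]
  ext e
  rw [coeff_homogeneousComponent, coeff_monomial, coeff_zero]
  split_ifs with h1 h2
  · subst h2; omega
  · rfl
  · rfl

theorem mul_mem_degLT {n d : ℕ} {s f : MvPolynomial ι k} (hs : s.IsHomogeneous n)
    (hf : f ∈ degLT k ι d) : s * f ∈ degLT k ι (n + d) := by
  refine (degLT_le (K := (degLT k ι (n + d)).comap (LinearMap.mulLeft k s)) ?_) hf
  intro m hm
  simp only [Submodule.mem_comap, LinearMap.mulLeft_apply]
  rw [s.as_sum, Finset.sum_mul]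
  refine sum_mem fun e he => ?_
  have hdeg : e.degree = n := by
    by_contra h
    exact (MvPolynomial.mem_support_iff.1 he) (hs.coeff_eq_zero h)
  have : monomial e (coeff e s) * monomial m 1 = coeff e s • monomial (e + m) (1 : k) := by
    rw [monomial_mul, smul_monomial]
    simp
  rw [this]
  refine Submodule.smul_mem _ _ (monomial_mem_degLT ?_)
  rw [map_add, hdeg]
  omega

theorem HasSymbol.component {n : ℕ} {D : MvPolynomial ι k →ₗ[k] MvPolynomial ι k}
    {s : MvPolynomial ι k} (h : HasSymbol n D s) : homogeneousComponent n (D 1) = s := by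
  have h1 : (1 : MvPolynomial ι k) ∈ degLT k ι (0 + 1) := by
    have : (1 : MvPolynomial ι k) = monomial 0 1 := rfl
    rw [this]
    exact monomial_mem_degLT (by simp)
  have h2 := homogeneousComponent_degLT (h.2 0 1 h1)
  rw [add_zero, map_sub, mul_one, sub_eq_zero] at h2
  rw [h2]
  exact (homogeneousComponent_of_mem h.1).trans (if_pos rfl)

theorem HasSymbol.mul {m n : ℕ} {D E : MvPolynomial ι k →ₗ[k] MvPolynomial ι k}
    {s t : MvPolynomial ι k} (h : HasSymbol m D s) (h' : HasSymbol n E t) :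
    HasSymbol (m + n) (D ∘ₗ E) (s * t) := by
  refine ⟨h.1.mul h'.1, fun d f hf => ?_⟩
  have key : ∀ e, ∀ g ∈ degLT k ι e, D g ∈ degLT k ι (m + e) := by
    intro e g hg
    rcases e with _ | e
    · rw [degLT_zero, Submodule.mem_bot] at hg
      rw [hg, map_zero]
      exact zero_mem _
    · have := add_mem (degLT_mono (by omega) (h.2 e g hg)) (mul_mem_degLT h.1 hg)
      simpa using this
  have h1 := key _ _ (h'.2 d f hf)
  have h2 := h.2 (n + d) (t * f) (mul_mem_degLT (d := d + 1) h'.1 hf)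
  have := add_mem h1 h2
  rw [map_sub, sub_add_sub_cancel, ← mul_assoc, ← add_assoc] at this
  exact this

theorem HasSymbol.add {n : ℕ} {D E : MvPolynomial ι k →ₗ[k] MvPolynomial ι k}
    {s t : MvPolynomial ι k} (h : HasSymbol n D s) (h' : HasSymbol n E t) :
    HasSymbol n (D + E) (s + t) := by
  refine ⟨h.1.add h'.1, fun d f hf => ?_⟩
  have := add_mem (h.2 d f hf) (h'.2 d f hf)
  rw [LinearMap.add_apply, add_mul, add_sub_add_comm]
  exact this

theorem hasSymbol_smul_one (r : k) :
    HasSymbol 0 (r • (1 : Module.End k (MvPolynomial ι k))) (C r) := by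
  refine ⟨isHomogeneous_C _ _, fun d f _ => ?_⟩
  rw [LinearMap.smul_apply, ← smul_eq_C_mul]
  simp

theorem hasSymbol_smul_one' (r : k) :
    HasSymbol 1 (r • (1 : Module.End k (MvPolynomial ι k))) 0 := by
  refine ⟨isHomogeneous_zero _ _ _, fun d f hf => ?_⟩
  rw [zero_mul, sub_zero, add_comm]
  exact Submodule.smul_mem _ _ hf

theorem hasSymbol_lieAct [LinearOrder ι] (br : A →ₗ[k] A →ₗ[k] A) (b : Module.Basis ι k A)
    (u : A) : HasSymbol 1 (lieAct br b u) (b.constr k (X : ι → MvPolynomial ι k) u) := by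
  constructor
  · rw [Module.Basis.constr_apply, ← mem_homogeneousSubmodule]
    exact sum_mem fun i _ => Submodule.smul_mem _ _ (isHomogeneous_X _ _)
  · intro d f hf
    rw [lieAct, Module.Basis.constr_apply, Module.Basis.constr_apply, Finsupp.sum, Finsupp.sum,
      LinearMap.sum_apply, Finset.sum_mul, ← Finset.sum_sub_distrib]
    refine sum_mem fun i _ => ?_
    rw [LinearMap.smul_apply, smul_mul_assoc, ← smul_sub, add_comm]
    exact Submodule.smul_mem _ _ (act_sub_mem br b i hf)

end Symbol

/-- The universal property of the free quantized algebra, for Poisson algebras as targets. -/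
theorem existsUnique_evaluation (B : PoissonBracket k A) (a b : A) :
    ∃! φ : FreeQuantized k →ₐ[k] A, IsEvaluation B a b φ := by
  classical
  suffices h : ∃ φ : FreeQuantized k →ₐ[k] A, IsEvaluation B a b φ from
    h.elim fun φ hφ => ⟨φ, hφ, fun ψ hψ => evaluation_unique B hψ hφ⟩
  let bas := Module.Basis.ofVectorSpace k A
  let ι := Module.Basis.ofVectorSpaceIndex k A
  let _ : LinearOrder ι := linearOrderOfSTO WellOrderingRel
  let S := MvPolynomial ι k
  let ρ : A →ₗ[k] Module.End k S := lieAct B.bracket bas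
  let e : A →ₗ[k] S := bas.constr k MvPolynomial.X
  let π : S →ₐ[k] A := MvPolynomial.aeval bas
  have hπe : ∀ u, π (e u) = u := by
    intro u
    have : π.toLinearMap ∘ₗ e = LinearMap.id := bas.ext fun i => by
      simp only [e, LinearMap.comp_apply, Module.Basis.constr_basis]
      exact MvPolynomial.aeval_X _ _
    exact congrArg (fun g => g u) this
  let lft : FreeAlgebra k (Fin 2) →ₐ[k] Module.End k S := FreeAlgebra.lift k ![ρ a, ρ b]
  have hρ : ∀ u v, ρ u * ρ v - ρ v * ρ u = ρ (B.bracket u v) := by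
    intro u v
    refine LinearMap.ext fun f => ?_
    exact lieAct_lie B.bracket bas B.self B.jacobi u v f
  have hlie : ∀ l ∈ freeLie k, ∃ u, lft l = ρ u := by
    intro l hl
    refine LieSubalgebra.lieSpan_induction
        (p := fun l _ => ∃ u, lft l = ρ u) k ?_ ?_ ?_ ?_ ?_ hl
    · rintro _ ⟨i, rfl⟩
      refine ⟨![a, b] i, ?_⟩
      rw [FreeAlgebra.lift_ι_apply]
      fin_cases i <;> rfl
    · exact ⟨0, by rw [map_zero, map_zero]⟩
    · rintro x y - - ⟨u, hu⟩ ⟨v, hv⟩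
      exact ⟨u + v, by rw [map_add, map_add, hu, hv]⟩
    · rintro r x - ⟨u, hu⟩
      exact ⟨r • u, by rw [map_smul, map_smul, hu]⟩
    · rintro x y - - ⟨u, hu⟩ ⟨v, hv⟩
      exact ⟨B.bracket u v, by rw [Ring.lie_def, map_sub, map_mul, map_mul, hu, hv, hρ]⟩
  let σ : ℕ → FreeAlgebra k (Fin 2) →ₗ[k] S := fun n =>
    MvPolynomial.homogeneousComponent n ∘ₗ LinearMap.applyₗ (1 : S) ∘ₗ lft.toLinearMap
  have hσ' : ∀ {n u s}, HasSymbol n (lft u) s → σ n u = s := fun h => h.component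
  have hsymb : ∀ n, ∀ u ∈ pbwFiltration k n, ∃ s, HasSymbol n (lft u) s := by
    intro n
    induction n with
    | zero =>
      intro u hu
      rw [pbwFiltration, pow_zero] at hu
      obtain ⟨r, rfl⟩ := Submodule.mem_one.1 hu
      refine ⟨MvPolynomial.C r, ?_⟩
      rw [AlgHom.commutes, Algebra.algebraMap_eq_smul_one]
      exact hasSymbol_smul_one r
    | succ n ih =>
      intro u hu
      rw [pbwFiltration, pow_succ'] at hu
      refine Submodule.mul_induction_on hu ?_ ?_
      · intro u hu v hv
        obtain ⟨t, ht⟩ := ih v hv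
        obtain ⟨r, hr, l, hl, rfl⟩ := Submodule.mem_sup.1 hu
        obtain ⟨r, rfl⟩ := Submodule.mem_one.1 hr
        obtain ⟨z, hz⟩ := hlie l hl
        refine ⟨(0 + e z) * t, ?_⟩
        rw [map_mul, map_add, AlgHom.commutes, Algebra.algebraMap_eq_smul_one, hz, add_comm n 1]
        exact ((hasSymbol_smul_one' r).add (hasSymbol_lieAct B.bracket bas z)).mul ht
      · rintro u v ⟨s, hs⟩ ⟨t, ht⟩
        exact ⟨s + t, by rw [map_add]; exact hs.add ht⟩
  have hσ : ∀ n, ∀ u ∈ pbwFiltration k n, HasSymbol n (lft u) (σ n u) := by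
    intro n u hu
    obtain ⟨s, hs⟩ := hsymb n u hu
    rw [hσ' hs]
    exact hs
  have hσmul : ∀ {m n u v}, u ∈ pbwFiltration k m → v ∈ pbwFiltration k n →
      σ (m + n) (u * v) = σ m u * σ n v := by
    intro m n u v hu hv
    apply hσ'
    rw [map_mul]
    exact (hσ m u hu).mul (hσ n v hv)
  let Θ : Polynomial (FreeAlgebra k (Fin 2)) → Polynomial A := fun f =>
    ∑ n ∈ f.support, Polynomial.monomial n (π (σ n (f.coeff n)))
  have hΘ : ∀ f n, (Θ f).coeff n = π (σ n (f.coeff n)) := by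
    intro f n
    simp only [Θ, Polynomial.finsetSum_coeff, Polynomial.coeff_monomial]
    rw [Finset.sum_ite_eq']
    split_ifs with h
    · rfl
    · rw [Polynomial.notMem_support_iff.1 h, map_zero, map_zero]
  have hσr : ∀ r : k, σ 0 (algebraMap k _ r) = MvPolynomial.C r := by
    intro r
    apply hσ'
    rw [AlgHom.commutes, Algebra.algebraMap_eq_smul_one]
    exact hasSymbol_smul_one r
  have hΘr : ∀ r : k, Θ (algebraMap k _ r) = algebraMap k _ r := by
    intro r
    ext n
    rw [hΘ, Polynomial.algebraMap_apply, Polynomial.algebraMap_apply, Polynomial.coeff_C,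
      Polynomial.coeff_C]
    split_ifs with h
    · subst h
      rw [hσr]
      exact π.commutes r
    · rw [map_zero, map_zero]
  let Ψ : FreeQuantized k →ₐ[k] Polynomial A :=
    { toFun := fun f => Θ f.1
      map_one' := by
        have := hΘr 1
        rw [map_one, map_one] at this
        exact this
      map_zero' := by
        have := hΘr 0
        rw [map_zero, map_zero] at this
        exact this
      map_add' := by
        intro f g
        ext n
        change (Θ (f.1 + g.1)).coeff n = (Θ f.1 + Θ g.1).coeff n
        rw [hΘ, Polynomial.coeff_add, Polynomial.coeff_add, map_add, map_add, hΘ, hΘ]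
      map_mul' := by
        intro f g
        ext n
        change (Θ (f.1 * g.1)).coeff n = (Θ f.1 * Θ g.1).coeff n
        rw [hΘ, Polynomial.coeff_mul, Polynomial.coeff_mul, map_sum, map_sum]
        refine Finset.sum_congr rfl fun ij hij => ?_
        rw [hΘ, hΘ, ← Finset.HasAntidiagonal.mem_antidiagonal.1 hij, hσmul (f.2 _) (g.2 _),
          map_mul]
      commutes' := hΘr }
  let φ : FreeQuantized k →ₐ[k] A := ((Polynomial.aeval (1 : A)).restrictScalars k).comp Ψ
  have hφ : ∀ n c (hc : c ∈ pbwFiltration k n),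
      φ ⟨Polynomial.monomial n c, monomial_mem_reesAlgebra k hc⟩ = π (σ n c) := by
    intro n c hc
    have : Θ (Polynomial.monomial n c) = Polynomial.monomial n (π (σ n c)) := by
      ext m
      rw [hΘ, Polynomial.coeff_monomial, Polynomial.coeff_monomial]
      split_ifs with h
      · rw [h]
      · rw [map_zero, map_zero]
    change Polynomial.aeval (1 : A) (Θ (Polynomial.monomial n c)) = _
    rw [this, Polynomial.aeval_monomial]
    simp
  have hφl : ∀ (l : freeLie k) (u : A), lft l.1 = ρ u → φ (quantLie k l) = u := by
    intro l u hu
    refine (hφ 1 l.1 (freeLie_mem_pbwFiltration k l.2)).trans ?_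
    have : σ 1 l.1 = e u := by
      apply hσ'
      rw [hu]
      exact hasSymbol_lieAct B.bracket bas u
    rw [this, hπe]
  have hφh : φ (quantH k) = 0 := by
    refine (hφ 1 1 (one_mem_pbwFiltration k)).trans ?_
    have : σ 1 1 = 0 := by
      apply hσ'
      have := hasSymbol_smul_one' (k := k) (ι := ι) 1
      rw [one_smul] at this
      rw [map_one]
      exact this
    rw [this, map_zero]
  refine ⟨φ, hφh, ?_, ?_, map_bracket_of_lie B φ hφh ?_⟩
  · exact hφl _ _ (by rw [FreeAlgebra.lift_ι_apply]; rfl)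
  · exact hφl _ _ (by rw [FreeAlgebra.lift_ι_apply]; rfl)
  · intro l l'
    obtain ⟨u, hu⟩ := hlie l.1 l.2
    obtain ⟨v, hv⟩ := hlie l'.1 l'.2
    rw [hφl l u hu, hφl l' v hv]
    apply hφl
    change lft ⁅l.1, l'.1⁆ = _
    rw [Ring.lie_def, map_sub, map_mul, map_mul, hu, hv, hρ]

end Existence

/-! ### Restricted Poisson algebras through the canonical quantized polynomial -/

section BK

variable {k : Type*} [Field k] {A : Type*} [CommRing A] [Algebra k A]

/-- The value `f(a, b)` of a quantized polynomial `f` at elements `a`, `b` of a Poisson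
algebra. -/
noncomputable def evaluate (B : PoissonBracket k A) (f : FreeQuantized k) (a b : A) : A :=
  (existsUnique_evaluation B a b).choose f

theorem isEvaluation_evaluate (B : PoissonBracket k A) (a b : A) :
    IsEvaluation B a b (existsUnique_evaluation B a b).choose :=
  (existsUnique_evaluation B a b).choose_spec.1

/-- The defining equation `h ^ (p - 1) P = (x y) ^ p - x ^ p y ^ p` of the canonical quantized
polynomial `P`. -/
def IsCanonicalPolynomial (p : ℕ) (P : FreeQuantized k) : Prop :=
  quantH k ^ (p - 1) * P = (quantX k * quantY k) ^ p - quantX k ^ p * quantY k ^ p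

/-- `pm` is a restricted Poisson structure in the sense of Bezrukavnikov and Kaledin: it is a
restricted Lie structure, and `(x y)^{p} = x^p y^{p} + y^p x^{p} + P(x, y)`, where `P` is to be
the canonical quantized polynomial. -/
structure IsRestrictedPoissonBK (B : PoissonBracket k A) (p : ℕ) (P : FreeQuantized k)
    (pm : A → A) : Prop where
  restrictedLie : IsRestrictedLie B.bracket p pm
  mul : ∀ x y, pm (x * y) = x ^ p * pm y + y ^ p * pm x + evaluate B P x y

end BK

end RestrictedPoisson

namespace RestrictedPoisson

/-! ### The polynomials `ad_{t x + y} ^ n` -/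

section LieCoeff

variable {k : Type*} [Field k] {M N : Type*} [AddCommGroup M] [Module k M]
  [AddCommGroup N] [Module k N]

/-! The whole theorem is one polarization, carried out first in the free quantized algebra and then
in `A`. In any associative algebra of characteristic `p`, Jacobson's formula
(`add_pow_char_eq_lieLambda`) says that `(x + y) ^ p - x ^ p - y ^ p` is `Λ_p` formed with the
commutator. In a quantized algebra the commutator is `h` times the bracket, and `Λ_p` consists of
`(p - 1)`-fold brackets, so this defect is `h ^ (p - 1) Λ_p(x, y)`, now with `Λ_p` of the bracket.

Expand the `p`-th power of `(x + y)² = (x² + y²) + (xy + yx)` in two ways: as the square of `(x + y)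
^ p`, and by Jacobson's formula for the sum on the right. Comparison determines `(xy + yx) ^ p`.
Passing from `xy + yx` to `2xy = (xy + yx) + h {x, y}` and from `y ^ p x ^ p` to `x ^ p y ^ p` costs
only further multiples of `h ^ (p - 1)`. Since `2` is invertible, this exhibits `(xy) ^ p - x ^ p y
^ p` as `h ^ (p - 1)` times an explicit element (`pow_mul_quantizedPhi`), and regularity of `h`
makes that element unique.

An evaluation preserves `Λ_p` and sends `h` to zero. The corrections vanish and what remains is
`Φ_p` (`IsEvaluation.map_quantizedPhi`).

The two notions of restricted structure are then compared with `Φ_p` in place of `P`. Applying the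
squaring rule to `x + y` gives the product rule, and the product rule at `x = y` gives back the
squaring rule because `Φ_p(x, x) = 0`. -/

/-- The polynomial `ad_{t x + y} ^ n` in a central variable `t`. -/
noncomputable def adPoly (br : M →ₗ[k] M →ₗ[k] M) (x y : M) (n : ℕ) :
    Polynomial (Module.End k M) :=
  (Polynomial.X * Polynomial.C (br x : Module.End k M)
    + Polynomial.C (br y : Module.End k M)) ^ n

theorem lieS_eq_coeff_adPoly (br : M →ₗ[k] M →ₗ[k] M) (p i : ℕ) (x y : M) :
    lieS br p i x y = (adPoly br x y (p - 1)).coeff (i - 1) x :=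
  rfl

theorem adPoly_zero_coeff (br : M →ₗ[k] M →ₗ[k] M) (x y : M) (j : ℕ) (z : M) :
    (adPoly br x y 0).coeff j z = if j = 0 then z else 0 := by
  rw [adPoly, pow_zero, Polynomial.coeff_one]
  split_ifs <;> rfl

/-- Splitting off the leftmost factor `t ad_x + ad_y` gives this recursion and the next one; the
inductions on iterated brackets rest on them. -/
theorem adPoly_succ_coeff_zero (br : M →ₗ[k] M →ₗ[k] M) (x y : M) (n : ℕ) (z : M) :
    (adPoly br x y (n + 1)).coeff 0 z = br y ((adPoly br x y n).coeff 0 z) := by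
  rw [adPoly, pow_succ', add_mul, Polynomial.coeff_add, mul_assoc, Polynomial.coeff_X_mul_zero,
    Polynomial.coeff_C_mul, zero_add]
  rfl

theorem adPoly_succ_coeff_succ (br : M →ₗ[k] M →ₗ[k] M) (x y : M) (n j : ℕ) (z : M) :
    (adPoly br x y (n + 1)).coeff (j + 1) z =
      br x ((adPoly br x y n).coeff j z) + br y ((adPoly br x y n).coeff (j + 1) z) := by
  rw [adPoly, pow_succ', add_mul, Polynomial.coeff_add, mul_assoc, Polynomial.coeff_X_mul,
    Polynomial.coeff_C_mul, Polynomial.coeff_C_mul]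
  rfl

/-- `Λ_p` is a linear combination of iterated brackets, so linearity and compatibility with brackets
suffice. This is what lets an evaluation pass through `Λ_p`. -/
theorem map_lieLambda {br : M →ₗ[k] M →ₗ[k] M} {br' : N →ₗ[k] N →ₗ[k] N} (φ : M →ₗ[k] N)
    (hφ : ∀ u v, φ (br u v) = br' (φ u) (φ v)) (p : ℕ) (x y : M) :
    φ (lieLambda br p x y) = lieLambda br' p (φ x) (φ y) := by
  have key : ∀ n j z, φ ((adPoly br x y n).coeff j z)
      = (adPoly br' (φ x) (φ y) n).coeff j (φ z) := by
    intro n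
    induction n with
    | zero =>
      intro j z
      rw [adPoly_zero_coeff, adPoly_zero_coeff, apply_ite φ, map_zero]
    | succ n ih =>
      rintro (_ | j) z
      · rw [adPoly_succ_coeff_zero, adPoly_succ_coeff_zero, hφ, ih]
      · rw [adPoly_succ_coeff_succ, adPoly_succ_coeff_succ, map_add, hφ, hφ, ih, ih]
  simp only [lieLambda, map_sum, map_smul, lieS_eq_coeff_adPoly, key]

theorem lieLambda_eq_zero {br : M →ₗ[k] M →ₗ[k] M} {p : ℕ} {x y : M}
    (h : ∀ j < p - 1, (adPoly br x y (p - 1)).coeff j x = 0) : lieLambda br p x y = 0 := by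
  refine Finset.sum_eq_zero fun i hi => ?_
  rw [Finset.mem_Icc] at hi
  rw [lieS_eq_coeff_adPoly, h _ (by omega), smul_zero]

/-- Since `p - 1 ≥ 1`, at least one bracket is taken, and the innermost one is `{x, x} = 0`. -/
theorem lieLambda_self {br : M →ₗ[k] M →ₗ[k] M} {p : ℕ} (hp : 2 ≤ p) {x : M}
    (hx : br x x = 0) : lieLambda br p x x = 0 := by
  refine lieLambda_eq_zero fun j _ => ?_
  obtain ⟨n, hn⟩ : ∃ n, p - 1 = n + 1 := ⟨p - 2, by omega⟩
  rw [hn]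
  clear * - hx
  induction n generalizing j with
  | zero =>
    rcases j with _ | j
    · rw [adPoly_succ_coeff_zero, adPoly_zero_coeff, if_pos rfl, hx]
    · rw [adPoly_succ_coeff_succ, adPoly_zero_coeff, adPoly_zero_coeff]
      split_ifs <;> simp [hx]
  | succ n ih =>
    rcases j with _ | j
    · rw [adPoly_succ_coeff_zero, ih, map_zero]
    · rw [adPoly_succ_coeff_succ, ih, ih, map_zero, add_zero]

/-- Only the power `t ^ (p - 1)` occurs in `(t ad_x) ^ (p - 1)`, just beyond the coefficients `0,
..., p - 2` that enter `Λ_p`. -/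
theorem lieLambda_zero_right (br : M →ₗ[k] M →ₗ[k] M) (p : ℕ) (x : M) :
    lieLambda br p x 0 = 0 := by
  refine lieLambda_eq_zero fun j hj => ?_
  rw [adPoly, map_zero, Polynomial.C_0, add_zero, (Polynomial.commute_X _).mul_pow,
    Polynomial.coeff_X_pow_mul', if_neg (by omega)]
  rfl

end LieCoeff

/-! ### Jacobson's formula -/

section Jacobson

/-- By Pascal's rule neighbouring entries of row `p - 1` add up to an entry of row `p`, which
vanishes modulo `p`; hence the signs alternate. -/
theorem cast_choose_char_pred {S : Type*} [Ring S] {p : ℕ} [CharP S p] (hp : p.Prime)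
    {j : ℕ} (hj : j < p) : ((p - 1).choose j : S) = (-1) ^ j := by
  induction j with
  | zero => simp
  | succ j ih =>
    have h1 : (p.choose (j + 1) : S) = 0 :=
      (CharP.cast_eq_zero_iff S p _).2 (hp.dvd_choose_self (by omega) hj)
    obtain ⟨q, rfl⟩ : ∃ q, p = q + 1 := ⟨p - 1, by omega⟩
    rw [Nat.choose_succ_succ, Nat.cast_add] at h1
    rw [pow_succ, mul_neg_one, ← ih (by omega)]
    exact eq_neg_of_add_eq_zero_right h1

/-- A division-free form of `(a - b) ^ p = a ^ p - b ^ p` divided by `a - b`: the signs of the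
binomial coefficients cancel those of `-b`. -/
theorem sub_pow_char_pred_of_commute {S : Type*} [Ring S] {p : ℕ} [CharP S p] (hp : p.Prime)
    {a b : S} (h : Commute a b) :
    (a - b) ^ (p - 1) = ∑ i ∈ Finset.range p, a ^ i * b ^ (p - 1 - i) := by
  rw [sub_eq_add_neg, h.neg_right.add_pow, Nat.sub_add_cancel hp.one_le]
  refine Finset.sum_congr rfl fun i hi => ?_
  rw [Finset.mem_range] at hi
  -- Reflecting the binomial coefficient gives the sign `(-1) ^ (p - 1 - i)`, with the same exponent
  -- as `-b`.
  rw [← Nat.choose_symm (show i ≤ p - 1 by omega), cast_choose_char_pred hp (by omega),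
    mul_assoc, ((Commute.neg_one_right _).pow_right _).eq, ← (Commute.neg_one_left _).mul_pow,
    neg_one_mul, neg_neg]

variable {k : Type*} [Field k] {R : Type*} [Ring R] [Algebra k R]

/-- The Leibniz rule without commutativity: `f'` must stay in its place between the powers of `f`.
-/
theorem derivative_pow_eq_sum (f : Polynomial R) (n : ℕ) :
    Polynomial.derivative (f ^ n)
      = ∑ i ∈ Finset.range n, f ^ i * Polynomial.derivative f * f ^ (n - 1 - i) := by
  induction n with
  | zero => simp
  | succ n ih =>
    rw [pow_succ', Polynomial.derivative_mul, ih, Finset.sum_range_succ', add_comm,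
      Finset.mul_sum]
    simp only [pow_zero, one_mul, Nat.add_sub_cancel, Nat.sub_zero]
    congr 1
    refine Finset.sum_congr rfl fun i _ => ?_
    rw [pow_succ', mul_assoc, mul_assoc, mul_assoc, Nat.sub_sub, add_comm 1 i]

variable (k R) in
/-- The commutator, as a bilinear map. -/
def commutator : R →ₗ[k] R →ₗ[k] R :=
  LinearMap.mul k R - (LinearMap.mul k R).flip

theorem commutator_apply (u v : R) : commutator k R u v = u * v - v * u :=
  rfl

/-- As `t` is central, the commutator with `t x + y` in `R[t]` acts as `t ad_x + ad_y`. This trades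
polynomials with endomorphism coefficients for endomorphisms of `R[t]`. -/
theorem coeff_adPoly_commutator (x y z : R) (n j : ℕ) :
    (adPoly (commutator k R) x y n).coeff j z =
      (((LinearMap.mulLeft k (Polynomial.X * Polynomial.C x + Polynomial.C y)
        - LinearMap.mulRight k (Polynomial.X * Polynomial.C x + Polynomial.C y) :
            Module.End k (Polynomial R)) ^ n)
          (Polynomial.C z)).coeff j := by
  induction n generalizing j with
  | zero => rw [adPoly_zero_coeff, pow_zero, Module.End.one_apply, Polynomial.coeff_C]
  | succ n ih =>
    rw [pow_succ', Module.End.mul_apply, LinearMap.sub_apply, LinearMap.mulLeft_apply,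
      LinearMap.mulRight_apply, add_mul, mul_add, mul_assoc, ← mul_assoc _ Polynomial.X,
      ← Polynomial.X_mul, mul_assoc]
    simp only [Polynomial.coeff_sub, Polynomial.coeff_add]
    rcases j with _ | j
    · rw [adPoly_succ_coeff_zero, commutator_apply, ih]
      simp only [Polynomial.coeff_X_mul_zero, Polynomial.coeff_C_mul, Polynomial.coeff_mul_C,
        zero_add]
    · rw [adPoly_succ_coeff_succ, commutator_apply, commutator_apply, ih, ih]
      simp only [Polynomial.coeff_X_mul, Polynomial.coeff_C_mul, Polynomial.coeff_mul_C]
      abel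

/-- Jacobson's formula for the `p`-th power of a sum. -/
theorem add_pow_char_eq_lieLambda {p : ℕ} [CharP k p] (hp : p.Prime) (x y : R) :
    (x + y) ^ p = x ^ p + y ^ p + lieLambda (commutator k R) p x y := by
  rcases subsingleton_or_nontrivial R with _ | _
  · exact Subsingleton.elim _ _
  have : CharP (Module.End k (Polynomial R)) p :=
    charP_of_injective_algebraMap (algebraMap k (Module.End k (Polynomial R))).injective p
  set f : Polynomial R := Polynomial.X * Polynomial.C x + Polynomial.C y with hf
  -- For `f = t x + y` the derivative of `f ^ p` is the sum of `f ^ i x f ^ (p - 1 - i)`. Left and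
  -- right multiplication by `f` commute, so that sum is `ad_f ^ (p - 1)` applied to `x`.
  have hder : Polynomial.derivative (f ^ p) = ((LinearMap.mulLeft k f - LinearMap.mulRight k f :
      Module.End k (Polynomial R)) ^ (p - 1)) (Polynomial.C x) := by
    rw [sub_pow_char_pred_of_commute hp (LinearMap.commute_mulLeft_right (R := k) f f),
      derivative_pow_eq_sum, LinearMap.sum_apply]
    refine Finset.sum_congr rfl fun i _ => ?_
    rw [LinearMap.pow_mulLeft, LinearMap.pow_mulRight, Module.End.mul_apply,
      LinearMap.mulLeft_apply, LinearMap.mulRight_apply, mul_assoc]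
    simp [hf, Polynomial.derivative_mul]
  -- Compare the coefficients of `t ^ j`: differentiation contributes the factor `j + 1`, which is
  -- invertible because `j + 1 < p`.
  have hcoeff : ∀ j < p - 1,
      ((j + 1 : ℕ) : k)⁻¹ • lieS (commutator k R) p (j + 1) x y = (f ^ p).coeff (j + 1) := by
    intro j hj
    have hne : ((j + 1 : ℕ) : k) ≠ 0 := by
      rw [Ne, CharP.cast_eq_zero_iff k p]
      exact Nat.not_dvd_of_pos_of_lt (by omega) (by omega)
    rw [lieS_eq_coeff_adPoly, Nat.add_sub_cancel, coeff_adPoly_commutator, ← hf, ← hder,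
      Polynomial.coeff_derivative, inv_smul_eq_iff₀ hne, Algebra.smul_def, map_natCast,
      Nat.cast_comm]
    push_cast
    rfl
  have hdeg : f.natDegree ≤ 1 := by
    rw [hf]
    compute_degree
  have hE : (x + y) ^ p = (f ^ p).eval 1 := by
    -- Evaluation at `t = 1` is multiplicative even over a noncommutative ring, since `1` is
    -- central.
    let E : Polynomial R →+* R :=
      Polynomial.eval₂RingHom' (RingHom.id R) 1 fun a => Commute.one_right a
    have h1 : E f = x + y := by
      rw [hf, map_add, map_mul]
      change Polynomial.eval 1 Polynomial.X * Polynomial.eval 1 (Polynomial.C x)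
        + Polynomial.eval 1 (Polynomial.C y) = _
      simp
    rw [← h1, ← map_pow]
    rfl
  have h0 : (f ^ p).coeff 0 = y ^ p := by
    change Polynomial.constantCoeff (f ^ p) = _
    rw [map_pow]
    simp [hf]
  have hp1 : (f ^ p).coeff p = x ^ p := by
    have := Polynomial.coeff_pow_of_natDegree_le (m := p) hdeg
    rw [mul_one] at this
    rw [this]
    simp [hf, Polynomial.coeff_C]
  -- Sum all coefficients of `f ^ p`: the extreme ones are `y ^ p` and `x ^ p`, and the middle ones
  -- make up `Λ_p`.
  rw [hE, Polynomial.eval_eq_sum_range' (n := p + 1)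
    (Nat.lt_succ_of_le ((Polynomial.natDegree_pow_le_of_le p hdeg).trans (mul_one p).le)),
    Finset.sum_range_succ, hp1]
  simp only [one_pow, mul_one]
  rw [lieLambda, ← Finset.Ico_add_one_right_eq_Icc, Finset.sum_Ico_eq_sum_range]
  have hr : Finset.range p = Finset.range (p - 1 + 1) := by rw [Nat.sub_add_cancel hp.one_le]
  rw [hr, Finset.sum_range_succ', h0, Nat.add_sub_cancel, add_comm _ (x ^ p), add_comm _ (y ^ p),
    ← add_assoc]
  congr 1
  refine Finset.sum_congr rfl fun j hj => ?_
  rw [← hcoeff j (Finset.mem_range.1 hj), add_comm j 1]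

end Jacobson

/-! ### Quantized algebras -/

section QuantizedBracket

variable {k : Type*} [Field k] {R : Type*} [Ring R] [Algebra k R]

/-- A bracket on `R` that quantizes the commutator with respect to a central regular `h`. -/
structure IsQuantizedBracket (h : R) (br : R →ₗ[k] R →ₗ[k] R) : Prop where
  comm : ∀ u, Commute h u
  cancel : ∀ {u v}, h * u = h * v → u = v
  mul_bracket : ∀ u v, h * br u v = u * v - v * u

/-- Regularity of `h` makes the quotient of `u v - v u` by `h` unique, and uniqueness forces the
chosen quotients to be bilinear. -/
theorem exists_isQuantizedBracket {h : R} (hc : ∀ u, Commute h u)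
    (hreg : ∀ {u v}, h * u = h * v → u = v) (hbr : ∀ u v, ∃ w, h * w = u * v - v * u) :
    ∃ br : R →ₗ[k] R →ₗ[k] R, IsQuantizedBracket h br := by
  choose f hf using hbr
  refine ⟨LinearMap.mk₂ k f ?_ ?_ ?_ ?_, ⟨hc, hreg, hf⟩⟩
  · intro u u' v
    apply hreg
    rw [mul_add, hf, hf, hf]
    noncomm_ring
  · intro c u v
    apply hreg
    rw [mul_smul_comm, hf, hf, smul_mul_assoc, mul_smul_comm, smul_sub]
  · intro u v v'
    apply hreg
    rw [mul_add, hf, hf, hf]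
    noncomm_ring
  · intro c u v
    apply hreg
    rw [mul_smul_comm, hf, hf, smul_mul_assoc, mul_smul_comm, smul_sub]

/-- The quotient of `(x y) ^ p - x ^ p y ^ p` by `h ^ (p - 1)`, in a quantized algebra. -/
noncomputable def quantizedPhi (h : R) (br : R →ₗ[k] R →ₗ[k] R) (p : ℕ)
    (x y : R) : R :=
  (2 : k)⁻¹ • ((x ^ p + y ^ p) * lieLambda br p x y + lieLambda br p x y * (x ^ p + y ^ p)
    + h ^ (p - 1) * lieLambda br p x y ^ 2
    - lieLambda br p (x ^ 2) (y ^ 2) - lieLambda br p (x ^ 2 + y ^ 2) (x * y + y * x)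
    + lieLambda br p (x * y + y * x) (h * br x y)
    + h * (br x y ^ p - ((br x : Module.End k R) ^ p) (y ^ p)))

namespace IsQuantizedBracket

variable {h : R} {br : R →ₗ[k] R →ₗ[k] R}

theorem bracket_mul (H : IsQuantizedBracket h br) (u v : R) : br u (h * v) = h * br u v := by
  apply H.cancel
  rw [H.mul_bracket, H.mul_bracket, mul_sub, ← mul_assoc u h v,
    ← (H.comm u).eq, mul_assoc, mul_assoc]

theorem bracket_pow_mul (H : IsQuantizedBracket h br) (u v : R) (n : ℕ) :
    br u (h ^ n * v) = h ^ n * br u v := by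
  induction n with
  | zero => simp
  | succ n ih => rw [pow_succ', mul_assoc, H.bracket_mul, ih, mul_assoc]

/-- The bracket is `h`-linear, so each commutator taken contributes exactly one more factor `h`. -/
theorem commutator_pow_mul (H : IsQuantizedBracket h br) (u v : R) (n : ℕ) :
    commutator k R u (h ^ n * v) = h ^ (n + 1) * br u v := by
  rw [commutator_apply, ← H.mul_bracket, H.bracket_pow_mul, pow_succ', mul_assoc]

theorem lieLambda_commutator (H : IsQuantizedBracket h br) (p : ℕ) (x y : R) :
    lieLambda (commutator k R) p x y = h ^ (p - 1) * lieLambda br p x y := by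
  have key : ∀ n j z, (adPoly (commutator k R) x y n).coeff j z
      = h ^ n * (adPoly br x y n).coeff j z := by
    intro n
    induction n with
    | zero =>
      intro j z
      rw [adPoly_zero_coeff, adPoly_zero_coeff, pow_zero, one_mul]
    | succ n ih =>
      rintro (_ | j) z
      · rw [adPoly_succ_coeff_zero, adPoly_succ_coeff_zero, ih, H.commutator_pow_mul]
      · rw [adPoly_succ_coeff_succ, adPoly_succ_coeff_succ, ih, ih, H.commutator_pow_mul,
          H.commutator_pow_mul, mul_add]
  simp only [lieLambda, lieS_eq_coeff_adPoly, key, Finset.mul_sum, mul_smul_comm]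

theorem add_pow (H : IsQuantizedBracket h br) {p : ℕ} [CharP k p] (hp : p.Prime) (x y : R) :
    (x + y) ^ p = x ^ p + y ^ p + h ^ (p - 1) * lieLambda br p x y := by
  rw [add_pow_char_eq_lieLambda (k := k) hp, H.lieLambda_commutator]

/-- Left and right multiplication by `x` commute, so in characteristic `p` the `p`-th power of their
difference is the commutator with `x ^ p`; the `p` commutators give `h ^ p`. The surplus over `h ^
(p - 1)` is why swapping `x ^ p` and `y ^ p` leaves no trace at `h = 0`. -/
theorem commutator_pow_pow (H : IsQuantizedBracket h br) {p : ℕ} [CharP k p] (hp : p.Prime)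
    (x y : R) : x ^ p * y - y * x ^ p = h ^ p * ((br x : Module.End k R) ^ p) y := by
  rcases subsingleton_or_nontrivial R with _ | _
  · exact Subsingleton.elim _ _
  have := Fact.mk hp
  have : CharP (Module.End k R) p :=
    charP_of_injective_algebraMap (algebraMap k (Module.End k R)).injective p
  have h1 : (commutator k R x : Module.End k R)
      = LinearMap.mulLeft k x - LinearMap.mulRight k x := rfl
  have h2 : ∀ n, ((commutator k R x : Module.End k R) ^ n) y
      = h ^ n * ((br x : Module.End k R) ^ n) y := by
    intro n
    induction n with
    | zero => simp
    | succ n ih =>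
      rw [pow_succ', Module.End.mul_apply, ih, H.commutator_pow_mul,
        pow_succ' (br x : Module.End k R), Module.End.mul_apply]
  rw [← h2, h1, sub_pow_char_of_commute _ (LinearMap.commute_mulLeft_right (R := k) x x),
    LinearMap.pow_mulLeft, LinearMap.pow_mulRight]
  rfl

/-- Two expansions of `((x + y)²) ^ p` are equated. The terms of `quantizedPhi` with a visible
factor `h` or with the argument `h {x, y}` correct for the noncommutativity of `x, y` and of `x ^ p,
y ^ p`; the term `h ^ (p - 1) Λ²` comes from squaring Jacobson's formula. -/
theorem pow_mul_quantizedPhi (H : IsQuantizedBracket h br) {p : ℕ} [CharP k p] (hp : p.Prime)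
    (hp2 : (2 : k) ≠ 0) (x y : R) :
    h ^ (p - 1) * quantizedPhi h br p x y = (x * y) ^ p - x ^ p * y ^ p := by
  have := Fact.mk hp
  have hhp : h ^ (p - 1) * h = h ^ p := by
    rw [← pow_succ, Nat.sub_add_cancel hp.one_le]
  have hcomm : ∀ u, Commute (h ^ (p - 1)) u := fun u => (H.comm u).pow_left _
  set Λ := lieLambda br p x y with hΛ
  set N := x * y + y * x with hN
  set W := br x y with hW
  set V := ((br x : Module.End k R) ^ p) (y ^ p) with hV
  have hVeq : x ^ p * y ^ p - y ^ p * x ^ p = h ^ (p - 1) * (h * V) := by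
    rw [H.commutator_pow_pow hp, ← mul_assoc, hhp]
  have two_pow : (2 : k) ^ p = 2 := by
    rw [← one_add_one_eq_two, add_pow_char, one_pow]
  -- First expansion: the square of `(x + y) ^ p`.
  have h1 : ((x + y) ^ 2) ^ p = x ^ p * x ^ p + y ^ p * y ^ p + x ^ p * y ^ p + y ^ p * x ^ p
      + h ^ (p - 1) * ((x ^ p + y ^ p) * Λ + Λ * (x ^ p + y ^ p) + h ^ (p - 1) * Λ ^ 2) := by
    rw [← pow_mul, mul_comm, pow_mul, H.add_pow hp, ← hΛ, sq, add_mul _ _ (x ^ p + y ^ p + _),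
      mul_add (x ^ p + y ^ p) (x ^ p + y ^ p), ← mul_assoc (x ^ p + y ^ p),
      ← (hcomm (x ^ p + y ^ p)).eq, mul_add (h ^ (p - 1) * Λ), mul_assoc _ Λ (h ^ (p - 1) * Λ),
      ← mul_assoc Λ _ Λ, ← (hcomm Λ).eq]
    noncomm_ring
  -- Second expansion: Jacobson's formula for `(x² + y²) + N`, and again for `x² + y²`.
  have h2 : ((x + y) ^ 2) ^ p = x ^ p * x ^ p + y ^ p * y ^ p
      + h ^ (p - 1) * lieLambda br p (x ^ 2) (y ^ 2) + N ^ p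
      + h ^ (p - 1) * lieLambda br p (x ^ 2 + y ^ 2) N := by
    have : (x + y) ^ 2 = (x ^ 2 + y ^ 2) + N := by
      rw [hN]; noncomm_ring
    rw [this, H.add_pow hp, H.add_pow hp, ← pow_mul, ← pow_mul, mul_comm 2 p, pow_mul, pow_mul,
      sq, sq]
  -- Jacobson's formula for `2xy = N + h W`, using `2 ^ p = 2` and the centrality of `h`.
  have h3 : (2 : k) • (x * y) ^ p = N ^ p + h ^ (p - 1) * (h * W ^ p)
      + h ^ (p - 1) * lieLambda br p N (h * W) := by
    have e : (2 : k) • (x * y) = N + h * W := by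
      rw [hN, hW, H.mul_bracket, two_smul]
      abel
    rw [← mul_assoc, hhp, ← (H.comm W).mul_pow, ← H.add_pow hp, ← e, smul_pow, two_pow]
  rw [quantizedPhi, ← hΛ, ← hN, ← hW, ← hV, mul_smul_comm, inv_smul_eq_iff₀ hp2, smul_sub, h3,
    two_smul]
  simp only [mul_add, mul_sub] at h1 h2 hVeq ⊢
  -- Equating the expansions isolates `N ^ p`, and `hVeq` turns `y ^ p x ^ p` into `x ^ p y ^ p`.
  -- Only additive normalization is available, as the ring is not commutative.
  linear_combination (norm := abel) h1.symm.trans h2 + hVeq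

end IsQuantizedBracket

end QuantizedBracket

/-! ### The canonical polynomial: commutators divisible by `h`, uniqueness, and reduction at `h =
0`. -/

section CanonicalPolynomial

variable {k : Type*} [Field k]

/-- For fixed `v`, the `u` whose commutator with `v` is divisible by `h` form a subalgebra, by the
Leibniz rule. It contains `h`, so only Lie elements have to be checked. -/
theorem exists_quantH_mul_eq_commutator (u v : FreeQuantized k) :
    ∃ w, quantH k * w = u * v - v * u := by
  let D : FreeQuantized k → FreeQuantized k → Prop := fun u v =>
    ∃ w, quantH k * w = u * v - v * u
  have hskew : ∀ {u v}, D u v → D v u := by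
    rintro u v ⟨w, hw⟩
    exact ⟨-w, by rw [mul_neg, hw, neg_sub]⟩
  let C : FreeQuantized k → Subalgebra k (FreeQuantized k) := fun v =>
    { carrier := {u | D u v}
      mul_mem' := by
        rintro u u' ⟨w, hw⟩ ⟨w', hw'⟩
        refine ⟨u * w' + w * u', ?_⟩
        rw [mul_add, ← mul_assoc, quantH_comm u, mul_assoc, hw', ← mul_assoc, hw]
        noncomm_ring
      add_mem' := by
        rintro u u' ⟨w, hw⟩ ⟨w', hw'⟩
        refine ⟨w + w', ?_⟩
        rw [mul_add, hw, hw']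
        noncomm_ring
      algebraMap_mem' := fun r => ⟨0, by rw [mul_zero, Algebra.commutes, sub_self]⟩ }
  have hC : ∀ v, (∀ l, D (quantLie k l) v) → ∀ u, D u v := by
    intro v hv u
    have : C v = ⊤ :=
      freeQuantized_generated ⟨0, by rw [mul_zero, quantH_comm, sub_self]⟩ hv
    exact (this.symm ▸ Algebra.mem_top : u ∈ C v)
  -- Generation is used twice: for a Lie element in the second slot, then, after skew symmetry, for
  -- arbitrary `v`.
  exact hC v (fun l => hskew (hC _ (fun l' => ⟨_, quantH_mul_lie l' l⟩) v)) u

theorem quantH_pow_mul_cancel (n : ℕ) {w w' : FreeQuantized k}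
    (h : quantH k ^ n * w = quantH k ^ n * w') : w = w' := by
  induction n with
  | zero => simpa using h
  | succ n ih =>
    rw [pow_succ', mul_assoc, mul_assoc] at h
    exact ih (quantH_mul_cancel h)

theorem isCanonicalPolynomial_unique {p : ℕ} {P P' : FreeQuantized k}
    (h : IsCanonicalPolynomial p P) (h' : IsCanonicalPolynomial p P') : P = P' :=
  quantH_pow_mul_cancel _ (h.trans h'.symm)

variable {A : Type*} [CommRing A] [Algebra k A]

/-- At `h = 0` the corrections vanish, `Λ_p(N, h W)` because its second argument becomes zero. In
the commutative target the two products of `Λ_p` with `x ^ p + y ^ p` coincide, which absorbs the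
factor `1/2`. -/
theorem IsEvaluation.map_quantizedPhi {B : PoissonBracket k A} {a b : A}
    {φ : FreeQuantized k →ₐ[k] A} (hφ : IsEvaluation B a b φ)
    {br : FreeQuantized k →ₗ[k] FreeQuantized k →ₗ[k] FreeQuantized k}
    (H : IsQuantizedBracket (quantH k) br) {p : ℕ} (hp : 2 ≤ p) (hp2 : (2 : k) ≠ 0) :
    φ (quantizedPhi (quantH k) br p (quantX k) (quantY k)) = poissonPhi B p a b := by
  have hΛ : ∀ u v, φ (lieLambda br p u v) = lieLambda B.bracket p (φ u) (φ v) :=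
    map_lieLambda φ.toLinearMap (fun u v => hφ.map_bracket u v _ (H.mul_bracket u v)) p
  have h0 : (0 : A) ^ (p - 1) = 0 := zero_pow (by omega)
  simp only [quantizedPhi, map_smul, map_add, map_sub, map_mul, map_pow, hΛ, hφ.map_h, hφ.map_x,
    hφ.map_y, zero_mul, lieLambda_zero_right, h0, add_zero]
  rw [poissonPhi, inv_smul_eq_iff₀ hp2, smul_sub, smul_inv_smul₀ hp2, two_smul, mul_comm b a,
    ← two_mul (a * b)]
  ring

end CanonicalPolynomial

/-! ### Comparison of the two compatibility conditions -/

section Comparison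

variable {k : Type*} [Field k] {A : Type*} [CommRing A] [Algebra k A]

/-- On the diagonal every `Λ_p` in `Φ_p` has equal arguments; in the last one both are `2x²`. -/
theorem poissonPhi_self (B : PoissonBracket k A) {p : ℕ} (hp : 2 ≤ p) (x : A) :
    poissonPhi B p x x = 0 := by
  rw [poissonPhi, lieLambda_self hp (B.self x), lieLambda_self hp (B.self _), ← sq,
    two_mul, lieLambda_self hp (B.self _)]
  simp

/-- Polarization: the squaring rule at `x + y` is expanded on both sides by additivity up to `Λ_p`,
and `2` is cancelled. -/
theorem IsRestrictedPoisson.map_mul {B : PoissonBracket k A} {p : ℕ} [CharP k p] (hp : p.Prime)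
    (hp2 : (2 : k) ≠ 0) {pm : A → A} (h : IsRestrictedPoisson B p pm) (x y : A) :
    pm (x * y) = x ^ p * pm y + y ^ p * pm x + poissonPhi B p x y := by
  -- The zero ring is set aside because it does not have characteristic `p`.
  rcases subsingleton_or_nontrivial A with _ | _
  · exact Subsingleton.elim _ _
  have := Fact.mk hp
  have : CharP A p := charP_of_injective_algebraMap (algebraMap k A).injective p
  have two_pow : (2 : k) ^ p = 2 := by
    rw [← one_add_one_eq_two, add_pow_char, one_pow]
  -- Homogeneity gives the factor `2 ^ p`, which is `2` since `2` lies in the prime field.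
  have h2 : pm (2 * (x * y)) = 2 * pm (x * y) := by
    have := h.restrictedLie.smul 2 (x * y)
    rwa [two_pow, two_smul, two_smul, ← two_mul, ← two_mul] at this
  have h1 := h.sq (x + y)
  rw [show (x + y) ^ 2 = x ^ 2 + y ^ 2 + 2 * (x * y) by ring, h.restrictedLie.add,
    h.restrictedLie.add, h.sq, h.sq, h2, h.restrictedLie.add, add_pow_char] at h1
  refine smul_right_injective A hp2 ?_
  simp only [poissonPhi, smul_add, smul_sub, smul_inv_smul₀ hp2]
  simp only [two_smul]
  linear_combination h1

theorem isRestrictedPoisson_iff_map_mul (B : PoissonBracket k A) {p : ℕ} [CharP k p]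
    (hp : p.Prime) (hp2 : (2 : k) ≠ 0) (pm : A → A) :
    IsRestrictedPoisson B p pm ↔ IsRestrictedLie B.bracket p pm ∧
      ∀ x y, pm (x * y) = x ^ p * pm y + y ^ p * pm x + poissonPhi B p x y := by
  refine ⟨fun h => ⟨h.restrictedLie, h.map_mul hp hp2⟩, fun h => ⟨h.1, fun x => ?_⟩⟩
  rw [sq, h.2, poissonPhi_self B hp.two_le]
  ring

end Comparison

end RestrictedPoisson

/-! ### The main theorem. -/

open RestrictedPoisson in
theorem lemma3p7 {k : Type*} [Field k] (p : ℕ) [CharP k p] (hp : 3 ≤ p) :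
    (∃! P : RestrictedPoisson.FreeQuantized k, RestrictedPoisson.IsCanonicalPolynomial p P) ∧
    ∀ P : RestrictedPoisson.FreeQuantized k, RestrictedPoisson.IsCanonicalPolynomial p P →
      ∀ (A : Type*) [CommRing A] [Algebra k A] (B : RestrictedPoisson.PoissonBracket k A),
        (∀ x y : A, RestrictedPoisson.evaluate B P x y = RestrictedPoisson.poissonPhi B p x y) ∧
        ∀ pm : A → A, RestrictedPoisson.IsRestrictedPoisson B p pm ↔
          RestrictedPoisson.IsRestrictedPoissonBK B p P pm := by
  have hprime : p.Prime := (CharP.char_is_prime_or_zero k p).resolve_right (by omega)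
  have hp2 : (2 : k) ≠ 0 := by
    have : ((2 : ℕ) : k) ≠ 0 := by
      rw [Ne, CharP.cast_eq_zero_iff k p]
      exact Nat.not_dvd_of_pos_of_lt two_pos hp
    exact_mod_cast this
  obtain ⟨br, H⟩ : ∃ br : FreeQuantized k →ₗ[k] FreeQuantized k →ₗ[k] FreeQuantized k,
      IsQuantizedBracket (quantH k) br :=
    exists_isQuantizedBracket quantH_comm quantH_mul_cancel exists_quantH_mul_eq_commutator
  have hcan : IsCanonicalPolynomial p (quantizedPhi (quantH k) br p (quantX k) (quantY k)) :=
    H.pow_mul_quantizedPhi hprime hp2 _ _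
  refine ⟨⟨_, hcan, fun P hP => isCanonicalPolynomial_unique hP hcan⟩, ?_⟩
  intro P hP A _ _ B
  -- By uniqueness `P` is the explicit `quantizedPhi`, whose evaluations are known.
  obtain rfl := isCanonicalPolynomial_unique hP hcan
  have heval : ∀ x y : A, evaluate B _ x y = poissonPhi B p x y := fun x y =>
    (isEvaluation_evaluate B x y).map_quantizedPhi H hprime.two_le hp2
  refine ⟨heval, fun pm => ?_⟩
  rw [isRestrictedPoisson_iff_map_mul B hprime hp2]
  refine ⟨fun h => ⟨h.1, fun x y => ?_⟩, fun h => ⟨h.restrictedLie, fun x y => ?_⟩⟩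
  · rw [heval, h.2]
  · rw [← heval, h.mul]
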